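/- Consider a planar swimmer consisting of three rigid magnetized segments $S_1,S_2,S_3$ of the same length $\ell>0$, with drag coefficients $\xi,\eta>0$ and magnetic moments $M_1,M_2,M_3\in\mathbb R$, $M_3\neq 0$, joined by two torsional springs of stiffness $\kappa\neq 0$. The state is $Z=(x,y,\theta,\alpha_1,\alpha_2)\in\mathbb R^5$: $(x,y)$ is the free end of $S_1$, $\theta$ is the angle of $S_1$ with the $x$-axis, $\alpha_1$ is the angle from $S_1$ to $S_2$ and $\alpha_2$ the angle from $S_2$ to $S_3$. The rest angles of the two springs are $0$ and $\alpha_0\in(-\pi,\pi)$. A point of $S_i$ with velocity $u_{\parallel}\mathbf e_{i,\parallel}+u_{\bot}\mathbf e_{i,\bot}$, in the moving frame of $S_i$, is subject to the drag force $-\xi u_{\parallel}\mathbf e_{i,\parallel}-\eta u_{\bot}\mathbf e_{i,\bot}$ per unit length. Let $R_\theta=\begin{pmatrix}\cos\theta&-\sin\theta\\ \sin\theta&\cos\theta\end{pmatrix}\oplus I_3$, and let $M(\alpha_1,\alpha_2)$ be the (invertible) $5\times5$ matrix that sends the velocity $R_{-\theta}\dot Z$ to the vector consisting of the two components, in the frame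 of $S_1$, of the total drag force, and of the drag torques on $S_1\cup S_2\cup S_3$, on $S_2\cup S_3$ and on $S_3$, taken about the first end point of $S_1$, $S_2$ and $S_3$ respectively. Let $\mathbf X_3,\mathbf X_4,\mathbf X_5$ be the last three columns of $M^{-1}$ and put $$\mathbf F_0=-\kappa\big(\alpha_1\mathbf X_4+(\alpha_2-\alpha_0)\mathbf X_5\big),$$ $$\mathbf F_1=(M_2\sin\alpha_1+M_3\sin(\alpha_1+\alpha_2))(\mathbf X_3+\mathbf X_4)+M_3\sin(\alpha_1+\alpha_2)\mathbf X_5,$$ $$\mathbf F_2=-M_1\mathbf X_3-(M_2\cos\alpha_1+M_3\cos(\alpha_1+\alpha_2))(\mathbf X_3+\mathbf X_4)-M_3\cos(\alpha_1+\alpha_2)\mathbf X_5.$$ The swimmer is the control system $R_{-\theta}\dot Z=\mathbf F_0+H_{\parallel}\mathbf F_1+H_{\bot}\mathbf F_2$ with control $H=(H_{\parallel},H_{\bot})$, the components of the magnetic field in the frame of $S_1$. Assume $\alpha_0\neq0$, so that the swimmer is bent at rest. Then this control system is small-time locally partially controllable in the position $(x,y)$ at every equilibrium $Z^e=(x^e,y^e,\theta^e,0,\alpha_0)$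 (with $H=0$), where $(x^e,y^e,\theta^e)\in\mathbb R^3$. That is, $Z^e$ is an equilibrium for $H=0$, and for every $\varepsilon>0$ there is $\delta>0$ such that for all $p^0,p^f\in B_\delta(x^e,y^e)$ and all $q^0\in B_\delta(\theta^e,0,\alpha_0)$ there is a control $H\in L^2([0,\varepsilon],\mathbb R^2)$ with $|H(t)|\le\varepsilon$ for all $t\in[0,\varepsilon]$ and a solution $Z$ of the system on $[0,\varepsilon]$ with $Z(0)=(p^0,q^0)$ and $(x,y)(\varepsilon)=p^f$. -/

import Mathlib

open MeasureTheory Set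

noncomputable section

/-! ### Small-time local partial controllability -/

section Control

variable {E U : Type*} [NormedAddCommGroup E] [NormedSpace ℝ E]

/-- `y` is a (Carathéodory) solution on `[0, T]` of the control system `ẏ = f (y, u)` driven by
the control `u`. -/
structure IsControlTrajectory (f : E → U → E) (T : ℝ) (u : ℝ → U) (y : ℝ → E) : Prop where
  continuousOn : ContinuousOn y (Icc 0 T)
  integrable : IntervalIntegrable (fun s => f (y s) (u s)) volume 0 T
  eq_integral : ∀ t ∈ Icc 0 T, y t = y 0 + ∫ s in (0 : ℝ)..t, f (y s) (u s)

end Control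

/-- The control system `(ẏ₁, ẏ₂) = f (y₁, y₂, u)` is small-time locally partially controllable
with respect to `y₁` at the equilibrium `(y₁ᵉ, y₂ᵉ, uᵉ)`. -/
def IsSTLPC {p q m : ℕ}
    (f : EuclideanSpace ℝ (Fin p) × EuclideanSpace ℝ (Fin q) → EuclideanSpace ℝ (Fin m) →
      EuclideanSpace ℝ (Fin p) × EuclideanSpace ℝ (Fin q))
    (y₁e : EuclideanSpace ℝ (Fin p)) (y₂e : EuclideanSpace ℝ (Fin q))
    (ue : EuclideanSpace ℝ (Fin m)) : Prop :=
  f (y₁e, y₂e) ue = 0 ∧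
  ∀ ε : ℝ, 0 < ε → ∃ δ : ℝ, 0 < δ ∧
    ∀ y₁0 ∈ Metric.ball y₁e δ, ∀ y₂0 ∈ Metric.ball y₂e δ, ∀ y₁f ∈ Metric.ball y₁e δ,
      ∃ u : ℝ → EuclideanSpace ℝ (Fin m),
        MemLp u 2 (volume.restrict (Icc 0 ε)) ∧
        (∀ t ∈ Icc 0 ε, ‖u t - ue‖ ≤ ε) ∧
        ∃ y : ℝ → EuclideanSpace ℝ (Fin p) × EuclideanSpace ℝ (Fin q),
          IsControlTrajectory f ε u y ∧ y 0 = (y₁0, y₂0) ∧ (y ε).1 = y₁f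

/-! ### The 3-link magnetic swimmer -/

/-- Physical parameters: segment length `ℓ`, tangential and normal drag coefficients `ξ`, `η`,
spring stiffness `κ`, magnetic moments `M₁`, `M₂`, `M₃`, rest angle `α₀` of the second spring. -/
structure SwimmerParams where
  ℓ : ℝ
  ξ : ℝ
  η : ℝ
  κ : ℝ
  M₁ : ℝ
  M₂ : ℝ
  M₃ : ℝ
  α₀ : ℝ

namespace SwimmerParams

/-- Cross product of two planar vectors (component along `e_z`). -/
def cross (a b : Fin 2 → ℝ) : ℝ := a 0 * b 1 - a 1 * b 0

/-- Unit vector making the angle `φ` with the first axis. -/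
def tang (φ : ℝ) : Fin 2 → ℝ := ![Real.cos φ, Real.sin φ]

/-- The unit vector `tang φ` rotated by `π / 2`. -/
def nrml (φ : ℝ) : Fin 2 → ℝ := ![-Real.sin φ, Real.cos φ]

variable (P : SwimmerParams)

/-! All vectors below are written in the moving frame of the first segment, with origin at the
end `(x, y)` of the first segment.  The shape angles are `α₁`, `α₂`.  A velocity
`V = (v_∥, v_⊥, θ̇, α̇₁, α̇₂)` consists of the components of `(ẋ, ẏ)` in that frame and of the
angular velocities. -/

/-- Angle of each of the three segments with the first one. -/
def segAngle (α₁ α₂ : ℝ) : Fin 3 → ℝ := ![0, α₁, α₁ + α₂]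

/-- Starting point of each segment. -/
def joint (α₁ α₂ : ℝ) : Fin 3 → Fin 2 → ℝ :=
  ![0, P.ℓ • tang (segAngle α₁ α₂ 0),
    P.ℓ • tang (segAngle α₁ α₂ 0) + P.ℓ • tang (segAngle α₁ α₂ 1)]

/-- The point at arc length `s` on segment `i`. -/
def segPoint (α₁ α₂ : ℝ) (i : Fin 3) (s : ℝ) : Fin 2 → ℝ :=
  P.joint α₁ α₂ i + s • tang (segAngle α₁ α₂ i)

/-- Angular velocity of each segment. -/
def segOmega (V : Fin 5 → ℝ) : Fin 3 → ℝ := ![V 2, V 2 + V 3, V 2 + V 3 + V 4]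

/-- Velocity of the starting point of each segment. -/
def jointVel (α₁ α₂ : ℝ) (V : Fin 5 → ℝ) : Fin 3 → Fin 2 → ℝ :=
  ![![V 0, V 1],
    ![V 0, V 1] + (P.ℓ * segOmega V 0) • nrml (segAngle α₁ α₂ 0),
    ![V 0, V 1] + (P.ℓ * segOmega V 0) • nrml (segAngle α₁ α₂ 0)
      + (P.ℓ * segOmega V 1) • nrml (segAngle α₁ α₂ 1)]

/-- Velocity of the point at arc length `s` on segment `i`. -/
def pointVel (α₁ α₂ : ℝ) (V : Fin 5 → ℝ) (i : Fin 3) (s : ℝ) : Fin 2 → ℝ :=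
  P.jointVel α₁ α₂ V i + (s * segOmega V i) • nrml (segAngle α₁ α₂ i)

/-- Drag force per unit length (Resistive Force Theory): `- ξ u_∥ e_∥ - η u_⊥ e_⊥`. -/
def dragDensity (α₁ α₂ : ℝ) (V : Fin 5 → ℝ) (i : Fin 3) (s : ℝ) : Fin 2 → ℝ :=
  -(P.ξ * (P.pointVel α₁ α₂ V i s ⬝ᵥ tang (segAngle α₁ α₂ i))) • tang (segAngle α₁ α₂ i)
    - (P.η * (P.pointVel α₁ α₂ V i s ⬝ᵥ nrml (segAngle α₁ α₂ i))) • nrml (segAngle α₁ α₂ i)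

/-- Total drag force on segment `i`. -/
def dragForce (α₁ α₂ : ℝ) (V : Fin 5 → ℝ) (i : Fin 3) : Fin 2 → ℝ :=
  fun k => ∫ s in (0 : ℝ)..P.ℓ, P.dragDensity α₁ α₂ V i s k

/-- Total drag torque on segment `i` with respect to the starting point of segment `k`. -/
def dragTorque (α₁ α₂ : ℝ) (V : Fin 5 → ℝ) (i k : Fin 3) : ℝ :=
  ∫ s in (0 : ℝ)..P.ℓ,
    cross (P.segPoint α₁ α₂ i s - P.joint α₁ α₂ k) (P.dragDensity α₁ α₂ V i s)

/-- The hydrodynamic terms of the balance of forces on the whole swimmer (two components), and of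
the balances of torques on the three subsystems consisting of all segments, the last two segments,
and the last segment, each with respect to the starting point of its first segment. -/
def hydro (α₁ α₂ : ℝ) (V : Fin 5 → ℝ) : Fin 5 → ℝ :=
  ![∑ i, P.dragForce α₁ α₂ V i 0,
    ∑ i, P.dragForce α₁ α₂ V i 1,
    P.dragTorque α₁ α₂ V 0 0 + P.dragTorque α₁ α₂ V 1 0 + P.dragTorque α₁ α₂ V 2 0,
    P.dragTorque α₁ α₂ V 1 1 + P.dragTorque α₁ α₂ V 2 1,
    P.dragTorque α₁ α₂ V 2 2]

/-- The matrix `M(α₁, α₂)` of the hydrodynamic terms as a function of the velocity. -/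
def dragMatrix (α₁ α₂ : ℝ) : Matrix (Fin 5) (Fin 5) ℝ :=
  Matrix.of fun i j => P.hydro α₁ α₂ (Pi.single j 1) i

/-! The matrix `M(α₁, α₂)` represents the hydrodynamic terms and is invertible. -/

theorem integral_quad (a b c l : ℝ) : ∫ s in (0:ℝ)..l, (a + b * s + c * s^2) = a*l+b*l^2/2+c*l^3/3 := by
  rw [intervalIntegral.integral_add, intervalIntegral.integral_add,
    intervalIntegral.integral_const_mul, intervalIntegral.integral_const_mul]
  · simp; ring
  all_goals apply Continuous.intervalIntegrable; fun_prop

theorem dragDensity_affine (α₁ α₂ : ℝ) (V : Fin 5 → ℝ) (i : Fin 3) (s : ℝ) (k) : P.dragDensity α₁ α₂ V i s k =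
   P.dragDensity α₁ α₂ V i 0 k + (P.dragDensity α₁ α₂ V i 1 k - P.dragDensity α₁ α₂ V i 0 k) * s := by
  simp [dragDensity, pointVel, dotProduct, Fin.sum_univ_two]; ring

theorem dragForce_eq (α₁ α₂ : ℝ) (V : Fin 5 → ℝ) (i : Fin 3) (k) : P.dragForce α₁ α₂ V i k =
   P.dragDensity α₁ α₂ V i 0 k * P.ℓ + (P.dragDensity α₁ α₂ V i 1 k - P.dragDensity α₁ α₂ V i 0 k) * P.ℓ^2/2 := by
  have := integral_quad (P.dragDensity α₁ α₂ V i 0 k) (P.dragDensity α₁ α₂ V i 1 k - P.dragDensity α₁ α₂ V i 0 k) 0 P.ℓ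
  simp only [zero_mul, add_zero, zero_div] at this
  rw [← this]
  exact intervalIntegral.integral_congr (fun s _ => dragDensity_affine ..)

theorem dragTorque_eq (α₁ α₂ : ℝ) (V : Fin 5 → ℝ) (i k : Fin 3) : P.dragTorque α₁ α₂ V i k =
   let f0 := P.dragDensity α₁ α₂ V i 0; let f1 := P.dragDensity α₁ α₂ V i 1 - f0
   let a := P.joint α₁ α₂ i - P.joint α₁ α₂ k ; let t := tang (segAngle α₁ α₂ i)
   cross a f0 * P.ℓ + (cross a f1 + cross t f0) * P.ℓ^2/2 + cross t f1 * P.ℓ^3/3 := by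
  rw [← integral_quad]
  refine intervalIntegral.integral_congr (fun s _ => ?_)
  simp only [cross, segPoint, dragDensity_affine P α₁ α₂ V i s, Pi.add_apply, Pi.sub_apply, Pi.smul_apply, smul_eq_mul]
  ring

set_option maxHeartbeats 2000000 in
/-- The hydrodynamic terms depend linearly on the velocity, through the matrix `M(α₁, α₂)`. -/
theorem dragMatrix_mulVec (α₁ α₂ : ℝ) (V : Fin 5 → ℝ) :
    (P.dragMatrix α₁ α₂).mulVec V = P.hydro α₁ α₂ V := by
  ext i
  simp only [Matrix.mulVec, dotProduct, dragMatrix, Matrix.of_apply, Fin.sum_univ_succ (n := 4), Fin.sum_univ_four, hydro]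
  fin_cases i <;>
  simp [dragForce_eq, dragTorque_eq, Fin.sum_univ_three, dragDensity, cross, pointVel, jointVel, joint, segOmega, segAngle, nrml, tang, dotProduct, Fin.sum_univ_two] <;>
  ring

/-- The power of the drag is the opposite of a sum of squares. -/
theorem dotProduct_hydro (α₁ α₂ : ℝ) (V : Fin 5 → ℝ) :
    V ⬝ᵥ P.hydro α₁ α₂ V = -∑ i,
      (∫ s in (0:ℝ)..P.ℓ, (P.ξ * (P.pointVel α₁ α₂ V i s ⬝ᵥ tang (segAngle α₁ α₂ i))^2
        + P.η * (P.pointVel α₁ α₂ V i s ⬝ᵥ nrml (segAngle α₁ α₂ i))^2)) := by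
  have h : ∀ i, (∫ s in (0:ℝ)..P.ℓ, (P.ξ * (P.pointVel α₁ α₂ V i s ⬝ᵥ tang (segAngle α₁ α₂ i))^2
        + P.η * (P.pointVel α₁ α₂ V i s ⬝ᵥ nrml (segAngle α₁ α₂ i))^2)) =
      let u0 := P.pointVel α₁ α₂ V i 0
      let u1 := segOmega V i • nrml (segAngle α₁ α₂ i)
      let f0 := P.dragDensity α₁ α₂ V i 0
      let f1 := P.dragDensity α₁ α₂ V i 1 - f0
      (-1) * (u0 ⬝ᵥ f0 * P.ℓ + (u0 ⬝ᵥ f1 + u1 ⬝ᵥ f0) * P.ℓ^2/2 + u1 ⬝ᵥ f1 * P.ℓ^3/3) := by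
    intro i
    simp only
    rw [← integral_quad, ← intervalIntegral.integral_const_mul]
    refine intervalIntegral.integral_congr (fun s _ => ?_)
    simp [dragDensity, pointVel, dotProduct, Fin.sum_univ_two]; ring
  simp only [h, hydro, dragForce_eq, dragTorque_eq]
  generalize P.dragDensity α₁ α₂ V = f
  simp [Fin.sum_univ_succ, cross, pointVel, jointVel, joint, segOmega, segAngle, nrml, tang, dotProduct]
  ring

theorem quad_zero {a b l : ℝ} (hl : 0 < l) : 0 ≤ a^2*l + a*b*l^2 + b^2*l^3/3 ∧
    (a^2*l + a*b*l^2 + b^2*l^3/3 = 0 → a = 0 ∧ b = 0) := by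
  have e : a^2*l + a*b*l^2 + b^2*l^3/3 = l * ((a + b*l/2)^2 + (b*l)^2/12) := by ring
  rw [e]
  refine ⟨by positivity, fun h => ?_⟩
  have h1 := (mul_eq_zero.1 h).resolve_left hl.ne'
  have h2 : (b*l)^2 = 0 := by nlinarith [sq_nonneg (a + b*l/2), sq_nonneg (b*l)]
  have h3 : b = 0 := by simpa [hl.ne'] using h2
  subst h3
  simpa using h1

/-- The matrix `M(α₁, α₂)` is invertible. -/
theorem det_dragMatrix_ne_zero (hℓ : 0 < P.ℓ) (hξ : 0 < P.ξ) (hη : 0 < P.η) (α₁ α₂ : ℝ) :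
    (P.dragMatrix α₁ α₂).det ≠ 0 := by
  intro h
  obtain ⟨V, hV, hz⟩ := Matrix.exists_mulVec_eq_zero_iff.2 h
  rw [dragMatrix_mulVec] at hz
  have hp := P.dotProduct_hydro α₁ α₂ V
  rw [hz, dotProduct_zero] at hp
  have hi : ∀ i, (∫ s in (0:ℝ)..P.ℓ, (P.ξ * (P.pointVel α₁ α₂ V i s ⬝ᵥ tang (segAngle α₁ α₂ i))^2
        + P.η * (P.pointVel α₁ α₂ V i s ⬝ᵥ nrml (segAngle α₁ α₂ i))^2)) =
      P.ξ * (P.pointVel α₁ α₂ V i 0 ⬝ᵥ tang (segAngle α₁ α₂ i))^2 * P.ℓ + P.η * (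
      (P.pointVel α₁ α₂ V i 0 ⬝ᵥ nrml (segAngle α₁ α₂ i))^2 * P.ℓ +
       (P.pointVel α₁ α₂ V i 0 ⬝ᵥ nrml (segAngle α₁ α₂ i)) * segOmega V i * P.ℓ^2 + (segOmega V i)^2 * P.ℓ^3/3) := by
    intro i
    set a := P.pointVel α₁ α₂ V i 0 ⬝ᵥ nrml (segAngle α₁ α₂ i) with ha
    set p := P.pointVel α₁ α₂ V i 0 ⬝ᵥ tang (segAngle α₁ α₂ i) with hpp
    have := integral_quad (P.ξ * p^2 + P.η * a^2) (P.η * (2 * a * segOmega V i)) (P.η * (segOmega V i)^2) P.ℓ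
    trans ∫ s in (0:ℝ)..P.ℓ, (P.ξ * p^2 + P.η * a^2 + (P.η * (2 * a * segOmega V i)) * s + (P.η * (segOmega V i)^2) * s^2)
    · refine intervalIntegral.integral_congr (fun s _ => ?_)
      have e1 : P.pointVel α₁ α₂ V i s ⬝ᵥ tang (segAngle α₁ α₂ i) = p := by
        simp [hpp, pointVel, dotProduct, nrml, tang, Fin.sum_univ_two]; ring
      have e2 : P.pointVel α₁ α₂ V i s ⬝ᵥ nrml (segAngle α₁ α₂ i) = a + s * segOmega V i := by
        have := Real.sin_sq_add_cos_sq (segAngle α₁ α₂ i)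
        simp [ha, pointVel, dotProduct, nrml, Fin.sum_univ_two]
        linear_combination (s * segOmega V i) * this
      simp only [e1, e2]; ring
    · rw [this]; ring
  simp only [hi] at hp
  have hn := fun i => quad_zero (a := P.pointVel α₁ α₂ V i 0 ⬝ᵥ nrml (segAngle α₁ α₂ i)) (b := segOmega V i) hℓ
  have hs := (Finset.sum_eq_zero_iff_of_nonneg (fun i _ => by
    have := (hn i).1
    positivity)).1 (neg_eq_zero.1 hp.symm)
  have hk : ∀ i, P.pointVel α₁ α₂ V i 0 ⬝ᵥ tang (segAngle α₁ α₂ i) = 0 ∧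
      P.pointVel α₁ α₂ V i 0 ⬝ᵥ nrml (segAngle α₁ α₂ i) = 0 ∧ segOmega V i = 0 := by
    intro i
    have h1 := hs i (Finset.mem_univ i)
    have h2 := (hn i).1
    have h3 : 0 ≤ P.ξ * (P.pointVel α₁ α₂ V i 0 ⬝ᵥ tang (segAngle α₁ α₂ i))^2 * P.ℓ := by positivity
    have h4 := mul_nonneg hη.le h2
    refine ⟨?_, (hn i).2 ?_⟩
    · have : P.ξ * (P.pointVel α₁ α₂ V i 0 ⬝ᵥ tang (segAngle α₁ α₂ i))^2 * P.ℓ = 0 := by linarith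
      simpa [hξ.ne', hℓ.ne'] using this
    · exact (mul_eq_zero.1 (by linarith : P.η * _ = 0)).resolve_left hη.ne'
  have k0 := hk 0
  have k1 := (hk 1).2.2
  have k2 := (hk 2).2.2
  simp [pointVel, jointVel, segOmega, segAngle, nrml, tang, dotProduct, Fin.sum_univ_two] at k0 k1 k2
  apply hV
  ext i
  fin_cases i <;> simp <;> linarith [k0.1, k0.2.1, k0.2.2]

/-- The third column of `M⁻¹`. -/
def X₃ (α₁ α₂ : ℝ) : Fin 5 → ℝ := fun i => (P.dragMatrix α₁ α₂)⁻¹ i 2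

/-- The fourth column of `M⁻¹`. -/
def X₄ (α₁ α₂ : ℝ) : Fin 5 → ℝ := fun i => (P.dragMatrix α₁ α₂)⁻¹ i 3

/-- The fifth column of `M⁻¹`. -/
def X₅ (α₁ α₂ : ℝ) : Fin 5 → ℝ := fun i => (P.dragMatrix α₁ α₂)⁻¹ i 4

/-- The drift `F₀`. -/
def F₀ (α₁ α₂ : ℝ) : Fin 5 → ℝ :=
  (-P.κ) • (α₁ • P.X₄ α₁ α₂ + (α₂ - P.α₀) • P.X₅ α₁ α₂)

/-- The control vector field `F₁`. -/
def F₁ (α₁ α₂ : ℝ) : Fin 5 → ℝ :=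
  (P.M₂ * Real.sin α₁ + P.M₃ * Real.sin (α₁ + α₂)) • (P.X₃ α₁ α₂ + P.X₄ α₁ α₂)
    + (P.M₃ * Real.sin (α₁ + α₂)) • P.X₅ α₁ α₂

/-- The control vector field `F₂`. -/
def F₂ (α₁ α₂ : ℝ) : Fin 5 → ℝ :=
  (-P.M₁) • P.X₃ α₁ α₂
    - (P.M₂ * Real.cos α₁ + P.M₃ * Real.cos (α₁ + α₂)) • (P.X₃ α₁ α₂ + P.X₄ α₁ α₂)
    - (P.M₃ * Real.cos (α₁ + α₂)) • P.X₅ α₁ α₂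

/-- The matrix `R_θ`: the rotation of angle `θ` on the first two coordinates, the identity on the
last three. -/
def rotMatrix (θ : ℝ) : Matrix (Fin 5) (Fin 5) ℝ :=
  !![Real.cos θ, -Real.sin θ, 0, 0, 0;
     Real.sin θ, Real.cos θ, 0, 0, 0;
     0, 0, 1, 0, 0;
     0, 0, 0, 1, 0;
     0, 0, 0, 0, 1]

theorem rotMatrix_neg_mul (θ : ℝ) : rotMatrix (-θ) * rotMatrix θ = 1 := by
  have h := Real.sin_sq_add_cos_sq θ
  ext i j
  fin_cases i <;> fin_cases j <;>
    simp [rotMatrix, Matrix.mul_apply, Fin.sum_univ_succ] <;> nlinarith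

/-- The velocity `Ż`, as a vector of `ℝ⁵`, determined by `R_{-θ} Ż = F₀ + H_∥ F₁ + H_⊥ F₂`. -/
def velocity (θ α₁ α₂ Hpar Hperp : ℝ) : Fin 5 → ℝ :=
  (rotMatrix θ).mulVec (P.F₀ α₁ α₂ + Hpar • P.F₁ α₁ α₂ + Hperp • P.F₂ α₁ α₂)

theorem rotMatrix_neg_mulVec_velocity (θ α₁ α₂ Hpar Hperp : ℝ) :
    (rotMatrix (-θ)).mulVec (P.velocity θ α₁ α₂ Hpar Hperp)
      = P.F₀ α₁ α₂ + Hpar • P.F₁ α₁ α₂ + Hperp • P.F₂ α₁ α₂ := by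
  rw [velocity, Matrix.mulVec_mulVec, rotMatrix_neg_mul, Matrix.one_mulVec]

/-- The system in its implicit form `M(α₁, α₂) R_{-θ} Ż = Y`, where `Y` collects the elastic and
magnetic terms. -/
theorem dragMatrix_mulVec_velocity (hℓ : 0 < P.ℓ) (hξ : 0 < P.ξ) (hη : 0 < P.η)
    (θ α₁ α₂ Hpar Hperp : ℝ) :
    (P.dragMatrix α₁ α₂).mulVec ((rotMatrix (-θ)).mulVec (P.velocity θ α₁ α₂ Hpar Hperp)) =
      ![0, 0,
        Hpar * (P.M₂ * Real.sin α₁ + P.M₃ * Real.sin (α₁ + α₂))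
          - Hperp * (P.M₁ + P.M₂ * Real.cos α₁ + P.M₃ * Real.cos (α₁ + α₂)),
        -P.κ * α₁ + Hpar * (P.M₂ * Real.sin α₁ + P.M₃ * Real.sin (α₁ + α₂))
          - Hperp * (P.M₂ * Real.cos α₁ + P.M₃ * Real.cos (α₁ + α₂)),
        -P.κ * (α₂ - P.α₀) + Hpar * P.M₃ * Real.sin (α₁ + α₂)
          - Hperp * P.M₃ * Real.cos (α₁ + α₂)] := by
  have hdet := P.det_dragMatrix_ne_zero hℓ hξ hη α₁ α₂
  have hcol : ∀ j, (P.dragMatrix α₁ α₂).mulVec (fun i => (P.dragMatrix α₁ α₂)⁻¹ i j)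
      = Pi.single j 1 := by
    intro j
    have h := Matrix.mul_nonsing_inv _ (isUnit_iff_ne_zero.2 hdet)
    ext i
    have hij := congrFun (congrFun h i) j
    simpa [Matrix.mul_apply, Matrix.mulVec, dotProduct, Matrix.one_apply, Pi.single_apply]
      using hij
  have h3 : (P.dragMatrix α₁ α₂).mulVec (P.X₃ α₁ α₂) = Pi.single 2 1 := hcol 2
  have h4 : (P.dragMatrix α₁ α₂).mulVec (P.X₄ α₁ α₂) = Pi.single 3 1 := hcol 3
  have h5 : (P.dragMatrix α₁ α₂).mulVec (P.X₅ α₁ α₂) = Pi.single 4 1 := hcol 4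
  rw [rotMatrix_neg_mulVec_velocity]
  simp only [F₀, F₁, F₂, Matrix.mulVec_add, Matrix.mulVec_sub, Matrix.mulVec_smul, h3, h4, h5]
  ext i
  fin_cases i <;> simp <;> ring

/-- The swimmer as a control system with state `Z = ((x, y), (θ, α₁, α₂))` and control
`(H_∥, H_⊥)`. -/
def vectorField (Z : EuclideanSpace ℝ (Fin 2) × EuclideanSpace ℝ (Fin 3))
    (H : EuclideanSpace ℝ (Fin 2)) : EuclideanSpace ℝ (Fin 2) × EuclideanSpace ℝ (Fin 3) :=
  let W := P.velocity (Z.2 0) (Z.2 1) (Z.2 2) (H 0) (H 1)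
  (!₂[W 0, W 1], !₂[W 2, W 3, W 4])

end SwimmerParams

end

/-! The tangential field alone steers the position. Keep `H_⊥ = 0` and linearise at rest: both `F₀`
and the control vanish there, so neither `R_θ` nor the columns of `M⁻¹` get differentiated. Up to
the rotation by `θ`, the control direction `b` is a nonzero multiple of `X₃ + X₄ + X₅`, the factor
containing `M₃ sin α₀`, and the linear drift `A` is `V ↦ -κ (V₃ X₄ + V₄ X₅)` (indices from 0), with
columns taken at `(0, α₀)`. The bend at rest is what makes `sin α₀`, hence `b`, nonzero.

The linear test `eventually_exists_steering` then reduces the claim to a partial Kalman condition: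
the position parts of the vectors `A ^ n b` span the plane. It is an open mapping argument on
curves: a pair (state, control) is sent to the defect in the integral equation together with the
final position. The strict derivative of this map at the equilibrium is onto by
`exists_linear_steering`, so the map is open there; trajectory and control are found simultaneously.

For the swimmer, `n = 0, 1, 2` suffice (`col_kalman`). The position parts of `b` and `A b` are
independent unless a polynomial in `ξ, η, cos α₀` vanishes. By `kalman_polynomials_coprime`, a
second polynomial is then nonzero, and `A² b` supplies the missing direction. -/

noncomputable section

/-! ### Operators on spaces of continuous curves. -/

section LinearTest

open Filter Topology

variable {E F G : Type*} [NormedAddCommGroup E] [NormedSpace ℝ E] [NormedAddCommGroup F]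
  [NormedSpace ℝ F] [NormedAddCommGroup G] [NormedSpace ℝ G]

/-- The superposition operator of a strictly differentiable map is strictly differentiable at
constants. -/
theorem hasStrictFDerivAt_superposition {K : Type*} [TopologicalSpace K] [CompactSpace K]
    {f : E → F} {f' : E →L[ℝ] F} {x : E} (hf : Continuous f) (hd : HasStrictFDerivAt f f' x) :
    HasStrictFDerivAt (fun g : C(K, E) => (⟨f, hf⟩ : C(E, F)).comp g)
      (f'.compLeftContinuous ℝ K) (ContinuousMap.const K x) := by
  rw [hasStrictFDerivAt_iff_isLittleO, Asymptotics.isLittleO_iff] at hd ⊢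
  intro c hc
  -- The base curve is constant, so a single radius `r` serves every time `t`; the pointwise
  -- estimate is then already uniform.
  obtain ⟨r, hr, hb⟩ := Metric.eventually_nhds_iff_ball.1 (hd hc)
  refine Metric.eventually_nhds_iff_ball.2 ⟨r, hr, fun g hg => ?_⟩
  refine (ContinuousMap.norm_le _ (by positivity)).2 fun t => ?_
  have h1 : (g.1 t, g.2 t) ∈ Metric.ball (x, x) r := by
    rw [Metric.mem_ball, Prod.dist_eq, max_lt_iff] at hg ⊢
    exact ⟨(ContinuousMap.dist_apply_le_dist (f := g.1) (g := .const K x) t).trans_lt hg.1,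
      (ContinuousMap.dist_apply_le_dist (f := g.2) (g := .const K x) t).trans_lt hg.2⟩
  refine (hb _ h1).trans ?_
  gcongr
  exact (g.1 - g.2).norm_coe_le_norm t

/-- The Volterra operator `g ↦ ∫₀ᵗ g` on `C([0, T], E)`. -/
def volterra (E : Type*) [NormedAddCommGroup E] [NormedSpace ℝ E] {T : ℝ} (hT : 0 ≤ T) :
    C(Icc 0 T, E) →L[ℝ] C(Icc 0 T, E) :=
  LinearMap.mkContinuous
    { toFun := fun g => ⟨fun t => ∫ s in (0 : ℝ)..t, IccExtend hT g s,
        (intervalIntegral.continuous_primitive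
          (fun a b => (g.continuous.Icc_extend').intervalIntegrable a b) 0).comp
            continuous_subtype_val⟩
      map_add' := fun g₁ g₂ => by
        ext t
        exact intervalIntegral.integral_add ((g₁.continuous.Icc_extend').intervalIntegrable _ _)
          ((g₂.continuous.Icc_extend').intervalIntegrable _ _)
      map_smul' := fun c g => by
        ext t
        exact intervalIntegral.integral_smul c _ } T (fun g => by
      refine (ContinuousMap.norm_le _ (by positivity)).2 fun t => ?_
      refine (intervalIntegral.norm_integral_le_of_norm_le_const
        (fun s _ => g.norm_coe_le_norm (projIcc 0 T hT s))).trans ?_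
      rw [mul_comm, sub_zero, abs_of_nonneg t.2.1]
      gcongr
      exact t.2.2)

/-! ### Linear systems: variation of constants and the partial Kalman condition. -/

section Linear

variable [CompleteSpace E] (A : E →L[ℝ] E)

theorem continuous_exp_smul : Continuous fun t : ℝ => NormedSpace.exp (t • A) :=
  continuous_iff_continuousAt.2 fun t => (hasDerivAt_exp_smul_const A t).continuousAt

theorem exp_add_smul_apply (s t : ℝ) (x : E) :
    NormedSpace.exp ((s + t) • A) x = NormedSpace.exp (s • A) (NormedSpace.exp (t • A) x) := by
  let _ : NormedAlgebra ℚ (E →L[ℝ] E) := NormedAlgebra.restrictScalars ℚ ℝ (E →L[ℝ] E)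
  rw [add_smul, NormedSpace.exp_add_of_commute ((Commute.refl A).smul_left s |>.smul_right t)]
  rfl

theorem exp_smul_apply_exp_neg_smul (t : ℝ) (x : E) :
    NormedSpace.exp (t • A) (NormedSpace.exp ((-t) • A) x) = x := by
  rw [← exp_add_smul_apply, add_neg_cancel, zero_smul, NormedSpace.exp_zero]
  rfl

/-- Variation of constants. -/
theorem hasDerivAt_duhamel {v : ℝ → E} (hv : Continuous v) (t : ℝ) :
    HasDerivAt (fun t => NormedSpace.exp (t • A)
        (∫ s in (0 : ℝ)..t, NormedSpace.exp ((-s) • A) (v s)))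
      (A (NormedSpace.exp (t • A) (∫ s in (0 : ℝ)..t, NormedSpace.exp ((-s) • A) (v s))) + v t)
      t := by
  have hc : Continuous fun s : ℝ => NormedSpace.exp ((-s) • A) (v s) :=
    ((continuous_exp_smul A).comp continuous_neg).clm_apply hv
  have h := (hasDerivAt_exp_smul_const' A t).clm_apply (hc.integral_hasStrictDerivAt 0 t).hasDerivAt
  rwa [exp_smul_apply_exp_neg_smul] at h

/-- If no nonzero functional vanishes on the curve `ρ`, then the integrals of `ρ` against
continuous weights exhaust the space. -/
theorem exists_integral_smul_eq [FiniteDimensional ℝ G] {T : ℝ} (hT : 0 < T) {ρ : ℝ → G}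
    (hρ : Continuous ρ) (h : ∀ l : G →ₗ[ℝ] ℝ, (∀ s ∈ Icc 0 T, l (ρ s) = 0) → l = 0) (q : G) :
    ∃ k : C(Icc 0 T, ℝ), ∫ s in (0 : ℝ)..T, IccExtend hT.le k s • ρ s = q := by
  have hi : ∀ k : C(Icc 0 T, ℝ), IntervalIntegrable (fun s => IccExtend hT.le k s • ρ s) volume 0 T :=
    fun k => (k.continuous.Icc_extend'.smul hρ).intervalIntegrable _ _
  let R : C(Icc 0 T, ℝ) →ₗ[ℝ] G :=
    { toFun := fun k => ∫ s in (0 : ℝ)..T, IccExtend hT.le k s • ρ s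
      map_add' := fun k₁ k₂ => by
        rw [← intervalIntegral.integral_add (hi k₁) (hi k₂)]
        exact intervalIntegral.integral_congr fun s _ => add_smul _ _ _
      map_smul' := fun c k => by
        rw [← intervalIntegral.integral_smul]
        exact intervalIntegral.integral_congr fun s _ => mul_smul _ _ _ }
  suffices hR : LinearMap.range R = ⊤ from LinearMap.range_eq_top.1 hR q
  by_contra hne
  obtain ⟨l, hl0, hl⟩ := Submodule.exists_le_ker_of_lt_top _ (lt_top_iff_ne_top.2 hne)
  refine hl0 (h l fun s hs => ?_)
  have hlc : Continuous fun s => l (ρ s) := (LinearMap.continuous_of_finiteDimensional l).comp hρ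
  -- Testing `l` against the weight `l ∘ ρ` itself turns the vanishing on the range into `∫ (l ∘ ρ)²
  -- = 0`.
  let k : C(Icc 0 T, ℝ) := ⟨fun t => l (ρ t), hlc.comp continuous_subtype_val⟩
  have hk : ∫ s in (0 : ℝ)..T, l (ρ s) * l (ρ s) = 0 := by
    have h0 : l (R k) = 0 := hl ⟨k, rfl⟩
    have : CompleteSpace G := FiniteDimensional.complete ℝ G
    have h1 : ∫ s in (0 : ℝ)..T, l (IccExtend hT.le k s • ρ s) = 0 :=
      ((LinearMap.toContinuousLinearMap l).intervalIntegral_comp_comm (hi k)).trans h0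
    refine Eq.trans ?_ h1
    refine intervalIntegral.integral_congr fun s hs => ?_
    rw [uIcc_of_le hT.le] at hs
    simp [IccExtend_of_mem hT.le _ hs, k]
  by_contra hs0
  exact (intervalIntegral.integral_pos hT (hlc.mul hlc).continuousOn
    (fun s _ => mul_self_nonneg _) ⟨s, hs, mul_self_pos.2 hs0⟩).ne' hk

/-- A functional that vanishes along `exp (t A) b` on an interval `[0, T]` vanishes at all
`A ^ k b`. -/
theorem apply_pow_eq_zero_of_apply_exp_eq_zero (l : E →L[ℝ] ℝ) (b : E) {T : ℝ} (hT : 0 < T)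
    (h : ∀ t ∈ Icc 0 T, l (NormedSpace.exp (t • A) b) = 0) (k : ℕ) : l ((A ^ k) b) = 0 := by
  -- Each differentiation in `t` brings down one factor `A`. The induction stays in the open
  -- interval, where two-sided derivatives are available; `t = 0` follows by closure.
  have hk : ∀ t ∈ Ioo 0 T, l ((A ^ k) (NormedSpace.exp (t • A) b)) = 0 := by
    induction k with
    | zero => exact fun t ht => h t (Ioo_subset_Icc_self ht)
    | succ k ih =>
      intro t ht
      have h1 : HasDerivAt (fun t : ℝ => l ((A ^ k) (NormedSpace.exp (t • A) b)))
          (l ((A ^ k) ((A * NormedSpace.exp (t • A)) b))) t := by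
        have := (hasDerivAt_exp_smul_const' A t).clm_apply (hasDerivAt_const t b)
        rw [map_zero, add_zero] at this
        exact (l.comp (A ^ k)).hasFDerivAt.comp_hasDerivAt t this
      have h2 : (fun t : ℝ => l ((A ^ k) (NormedSpace.exp (t • A) b))) =ᶠ[𝓝 t] fun _ => 0 := by
        filter_upwards [isOpen_Ioo.mem_nhds ht] with s hs using ih s hs
      have h3 := h1.unique ((hasDerivAt_const t (0 : ℝ)).congr_of_eventuallyEq h2)
      rw [pow_succ]
      exact h3
  have hc : Continuous fun t : ℝ => l ((A ^ k) (NormedSpace.exp (t • A) b)) :=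
    (l.comp (A ^ k)).continuous.comp ((continuous_exp_smul A).clm_apply continuous_const)
  have h0 : (0 : ℝ) ∈ closure (Ioo 0 T) := by
    rw [closure_Ioo hT.ne]; exact ⟨le_rfl, hT.le⟩
  have := (isClosed_eq hc continuous_const).closure_subset_iff.2 hk h0
  simpa using this

/-- Under the partial Kalman condition, the linear system `ḣ = A h + k b + ġ` can be steered in
time `T` to any prescribed value of `p h`. -/
theorem exists_linear_steering [FiniteDimensional ℝ G] {T : ℝ} (hT : 0 < T) (b : E)
    (p : E →L[ℝ] G) (hK : ∀ l : G →ₗ[ℝ] ℝ, (∀ n : ℕ, l (p ((A ^ n) b)) = 0) → l = 0)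
    (g : C(Icc 0 T, E)) (q : G) :
    ∃ (h : C(Icc 0 T, E)) (k : C(Icc 0 T, ℝ)),
      (∀ t : Icc 0 T, h t - ∫ s in (0 : ℝ)..t, (A (IccExtend hT.le h s) + IccExtend hT.le k s • b)
        = g t) ∧ p (h ⟨T, hT.le, le_rfl⟩) = q := by
  have hexp := continuous_exp_smul A
  have hexpn : Continuous fun s : ℝ => NormedSpace.exp ((-s) • A) := hexp.comp continuous_neg
  have hgc : Continuous (IccExtend hT.le g) := g.continuous.Icc_extend'
  let ρ : ℝ → G := fun s => p (NormedSpace.exp (T • A) (NormedSpace.exp ((-s) • A) b))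
  have hρ : Continuous ρ :=
    p.continuous.comp ((NormedSpace.exp (T • A)).continuous.comp (hexpn.clm_apply continuous_const))
  have hρ' : ∀ s, ρ s = p (NormedSpace.exp ((T - s) • A) b) := by
    intro s
    rw [sub_eq_add_neg, exp_add_smul_apply]
  let c : E := ∫ s in (0 : ℝ)..T, NormedSpace.exp ((-s) • A) (A (IccExtend hT.le g s))
  -- Put `h = g + w`, so that `w' = A w + A g + k b` with `w 0 = 0`. The weight `k` has to produce
  -- what remains of `q` once the contributions of `g T` and of the forcing `A g` are removed. The
  -- substitution `s = T - t` turns `ρ` into `p (exp (t A) b)`.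
  obtain ⟨k, hk⟩ := exists_integral_smul_eq hT hρ (fun l hl => hK l fun n => by
    refine apply_pow_eq_zero_of_apply_exp_eq_zero A
      ((LinearMap.toContinuousLinearMap l).comp p) b hT (fun t ht => ?_) n
    have := hl (T - t) ⟨by linarith [ht.2], by linarith [ht.1]⟩
    rwa [hρ', sub_sub_cancel] at this) (q - p (g ⟨T, hT.le, le_rfl⟩) - p (NormedSpace.exp (T • A) c))
  have hkc : Continuous (IccExtend hT.le k) := k.continuous.Icc_extend'
  let v : ℝ → E := fun s => A (IccExtend hT.le g s) + IccExtend hT.le k s • b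
  have hv : Continuous v := (A.continuous.comp hgc).add (hkc.smul continuous_const)
  let w : ℝ → E := fun t => NormedSpace.exp (t • A)
    (∫ s in (0 : ℝ)..t, NormedSpace.exp ((-s) • A) (v s))
  have hw : ∀ t, HasDerivAt w (A (w t) + v t) t := hasDerivAt_duhamel A hv
  have hwc : Continuous w := continuous_iff_continuousAt.2 fun t => (hw t).continuousAt
  have hw0 : w 0 = 0 := by simp [w]
  refine ⟨⟨fun t => g t + w t, g.continuous.add (hwc.comp continuous_subtype_val)⟩, k,
    fun t => ?_, ?_⟩
  · have hint : ∫ s in (0 : ℝ)..t, (A (w s) + v s) = w t := by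
      rw [intervalIntegral.integral_eq_sub_of_hasDerivAt (fun s _ => hw s)
        (((A.continuous.comp hwc).add hv).intervalIntegrable _ _), hw0, sub_zero]
    have hcongr : ∫ s in (0 : ℝ)..t, (A (IccExtend hT.le (fun t : Icc 0 T => g t + w t) s)
        + IccExtend hT.le k s • b) = w t := by
      rw [← hint]
      refine intervalIntegral.integral_congr fun s hs => ?_
      rw [uIcc_of_le t.2.1] at hs
      have hs' : s ∈ Icc 0 T := ⟨hs.1, hs.2.trans t.2.2⟩
      simp only [v, IccExtend_of_mem hT.le _ hs', map_add]
      abel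
    exact sub_eq_of_eq_add (congrArg (g t + ·) hcongr.symm)
  · have hsplit : ∫ s in (0 : ℝ)..T, NormedSpace.exp ((-s) • A) (v s) =
        c + ∫ s in (0 : ℝ)..T, IccExtend hT.le k s • NormedSpace.exp ((-s) • A) b := by
      rw [← intervalIntegral.integral_add]
      · exact intervalIntegral.integral_congr fun s _ => by simp [v]
      · exact (hexpn.clm_apply (A.continuous.comp hgc)).intervalIntegrable _ _
      · exact (hkc.smul (hexpn.clm_apply continuous_const)).intervalIntegrable _ _
    have hpull : p (NormedSpace.exp (T • A)
        (∫ s in (0 : ℝ)..T, IccExtend hT.le k s • NormedSpace.exp ((-s) • A) b)) =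
        q - p (g ⟨T, hT.le, le_rfl⟩) - p (NormedSpace.exp (T • A) c) := by
      rw [← hk, ← ContinuousLinearMap.intervalIntegral_comp_comm,
        ← ContinuousLinearMap.intervalIntegral_comp_comm]
      · simp [ρ]
      · exact ((NormedSpace.exp (T • A)).continuous.comp
          (hkc.smul (hexpn.clm_apply continuous_const))).intervalIntegrable _ _
      · exact (hkc.smul (hexpn.clm_apply continuous_const)).intervalIntegrable _ _
    change p (g ⟨T, hT.le, le_rfl⟩ + w T) = q
    simp only [w]
    rw [hsplit, map_add, map_add, map_add, hpull]
    abel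

end Linear

/-! ### Steering the nonlinear system by an open mapping argument. -/

/-- The linear test for local partial controllability: a control system with scalar control whose
linearisation at an equilibrium satisfies the partial Kalman condition can be steered, in any time
and with arbitrarily small controls, from every state near the equilibrium to every value of `p`
near its value at the equilibrium. -/
theorem eventually_exists_steering [CompleteSpace E] [FiniteDimensional ℝ G] {f : E × ℝ → E}
    {f' : E × ℝ →L[ℝ] E} {z₀ : E} (hf : Continuous f) (hd : HasStrictFDerivAt f f' (z₀, 0))
    (h₀ : f (z₀, 0) = 0) (p : E →L[ℝ] G)
    (hK : ∀ l : G →ₗ[ℝ] ℝ,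
      (∀ n : ℕ, l (p (((f'.comp (.inl ℝ E ℝ)) ^ n) (f' (0, 1)))) = 0) → l = 0)
    {T ε : ℝ} (hT : 0 < T) (hε : 0 < ε) :
    ∀ᶠ a : E × G in 𝓝 (z₀, p z₀), ∃ (y : ℝ → E) (u : ℝ → ℝ), Continuous y ∧ Continuous u ∧
      (∀ t, |u t| ≤ ε) ∧ (∀ t ∈ Icc 0 T, y t = a.1 + ∫ s in (0 : ℝ)..t, f (y s, u s)) ∧
      p (y T) = a.2 := by
  let K := Icc (0 : ℝ) T
  let T' : K := ⟨T, hT.le, le_rfl⟩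
  let J : C(K, E × ℝ) →L[ℝ] C(K, E) := (ContinuousLinearMap.fst ℝ E ℝ).compLeftContinuous ℝ K
  let ev : C(K, E) →L[ℝ] E := ContinuousMap.evalCLM ℝ T'
  -- A pair `z = (y, u)` is a trajectory from `a` with final value `q` exactly when `Ψ z` is the
  -- constant curve `a` paired with `q`.
  let Ψ : C(K, E × ℝ) → C(K, E) × G := fun z =>
    (J z - volterra E hT.le ((⟨f, hf⟩ : C(E × ℝ, E)).comp z), p (ev (J z)))
  let Ψ' : C(K, E × ℝ) →L[ℝ] C(K, E) × G :=
    (J - (volterra E hT.le).comp (f'.compLeftContinuous ℝ K)).prod (p.comp (ev.comp J))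
  let e : C(K, E × ℝ) := .const K (z₀, 0)
  have hΨ : HasStrictFDerivAt Ψ Ψ' e :=
    (J.hasStrictFDerivAt.sub ((volterra E hT.le).hasStrictFDerivAt.comp e
      (hasStrictFDerivAt_superposition hf hd))).prodMk (p.comp (ev.comp J)).hasStrictFDerivAt
  have hsurj : Ψ'.range = ⊤ := by
    refine LinearMap.range_eq_top.2 fun gq => ?_
    obtain ⟨h, k, hhk, hq⟩ := exists_linear_steering (f'.comp (.inl ℝ E ℝ)) hT (f' (0, 1)) p hK
      gq.1 gq.2
    refine ⟨h.prodMk k, Prod.ext (ContinuousMap.ext fun t => ?_) hq⟩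
    rw [← hhk t]
    refine congrArg (h t - ·) (intervalIntegral.integral_congr fun s _ => ?_)
    change f' (IccExtend hT.le h s, IccExtend hT.le k s) = _
    simp only [ContinuousLinearMap.comp_apply, ContinuousLinearMap.inl_apply]
    rw [← map_smul, ← map_add]
    simp
  have hmap := hΨ.map_nhds_eq_of_surj hsurj
  have hΨe : Ψ e = (.const K z₀, p z₀) := by
    refine Prod.ext (ContinuousMap.ext fun t => ?_) rfl
    change z₀ - ∫ s in (0 : ℝ)..t, f (z₀, 0) = z₀
    simp [h₀]
  -- The radius `ε` in the sup norm is what bounds the control by `ε`.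
  have hball : Metric.ball e ε ∈ 𝓝 e := Metric.ball_mem_nhds e hε
  have himg : Ψ '' Metric.ball e ε ∈ 𝓝 (Ψ e) := hmap ▸ image_mem_map hball
  rw [hΨe] at himg
  have hcont : Tendsto (fun a : E × G => ((.const K a.1 : C(K, E)), a.2)) (𝓝 (z₀, p z₀))
      (𝓝 (.const K z₀, p z₀)) :=
    (ContinuousMap.continuous_const'.prodMap continuous_id).tendsto (z₀, p z₀)
  filter_upwards [hcont himg] with a ha
  obtain ⟨z, hz, hza⟩ := ha
  have hza1 : ∀ t : K, (z t).1 - ∫ s in (0 : ℝ)..t, f (IccExtend hT.le z s) = a.1 := fun t =>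
    congrArg (fun c : C(K, E) × G => c.1 t) hza
  have hza2 : p (z T').1 = a.2 := congrArg Prod.snd hza
  have hzc : Continuous (IccExtend hT.le z) := z.continuous.Icc_extend'
  refine ⟨fun t => (IccExtend hT.le z t).1, fun t => (IccExtend hT.le z t).2,
    continuous_fst.comp hzc, continuous_snd.comp hzc, fun t => ?_, fun t ht => ?_, ?_⟩
  · have h1 : dist (z (projIcc 0 T hT.le t)) (z₀, 0) < ε :=
      (ContinuousMap.dist_apply_le_dist (f := z) (g := e) _).trans_lt hz
    rw [Prod.dist_eq, max_lt_iff] at h1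
    have := h1.2.le
    rwa [Real.dist_eq, sub_zero] at this
  · have := hza1 ⟨t, ht⟩
    simp only [IccExtend_of_mem hT.le z ht]
    exact sub_eq_iff_eq_add.1 this
  · simp only [IccExtend_of_mem hT.le z ⟨hT.le, le_rfl⟩]
    exact hza2

end LinearTest

/-! ### The algebraic non-degeneracy of the Kalman condition. -/

/-- Two quantities that decide whether the linearised swimmer is partially controllable have no
common zero. -/
theorem kalman_polynomials_coprime {ξ η c : ℝ} (hξ : 0 < ξ) (hη : 0 < η) (hc : c ^ 2 < 1)
    (h : (1 - c ^ 2) * (56 * ξ ^ 3 + 4 * η ^ 3) + ξ ^ 2 * η * (72 + 486 * c + 36 * c ^ 2)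
      + ξ * η ^ 2 * (30 + 171 * c + 24 * c ^ 2) = 0) :
    560 * (1 - c ^ 2) ^ 2 * ξ ^ 4
      + ξ ^ 3 * η * (1 - c ^ 2) * (1168 + 3096 * c + 1424 * c ^ 2)
      + ξ ^ 2 * η ^ 2 * (876 + 3204 * c + 2379 * c ^ 2 + 3924 * c ^ 3 + 1200 * c ^ 4)
      + ξ * η ^ 3 * (1 - c ^ 2) * (280 + 828 * c + 368 * c ^ 2)
      + 32 * η ^ 4 * (1 - c ^ 2) ^ 2 ≠ 0 := by
  obtain ⟨u, rfl⟩ : ∃ u, c = -u := ⟨-c, by ring⟩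
  have hσ : 0 < 1 - u ^ 2 := by linarith [neg_sq u]
  have hu1 : u < 1 := by nlinarith
  have hu2 : -1 < u := by nlinarith
  set σ := 1 - u ^ 2 with hσu
  set K := 486 * u - 72 - 36 * u ^ 2 with hK
  set L := 171 * u - 30 - 24 * u ^ 2 with hL
  set N := 266 + 303 * u - 1058 * u ^ 2 + 192 * u ^ 3 with hN
  have h1 : σ * (56 * ξ ^ 3 + 4 * η ^ 3) = ξ * η * (ξ * K + η * L) := by
    linear_combination h
  have hKL : 0 < ξ * K + η * L := by
    have h2 : 0 < ξ * η * (ξ * K + η * L) := h1 ▸ by positivity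
    exact pos_of_mul_pos_right h2 (by positivity)
  -- For `u ≤ 0` both `K` and `L` are negative, against `hKL`.
  have hu : 0 < u := by
    by_contra hu
    push Not at hu
    have : K < 0 := by nlinarith
    have : L < 0 := by nlinarith
    nlinarith
  -- Subtracting `σ (10 ξ + 8 η)` times the relation `h1` from the second polynomial leaves `9 ξ η
  -- u` times this factor. Up to `u = 7/10` one has `N > 0`. Beyond that `N` may be negative, and
  -- `σ` may be small.
  have hB : 0 < σ * (ξ ^ 2 * (196 + 168 * u) + η ^ 2 * (60 + 24 * u)) + ξ * η * N := by
    rcases le_total u (7 / 10) with h7 | h7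
    · have : 0 < N := by nlinarith [mul_nonneg hu.le (sub_nonneg.2 h7), pow_pos hu 3]
      positivity
    · have hN' : -297 ≤ N := by nlinarith [mul_nonneg (sub_nonneg.2 hu1.le) (sub_nonneg.2 h7)]
      have hK' : 100 ≤ K := by nlinarith
      have hL' : 50 ≤ L := by nlinarith
      -- This positive multiplier lets `h1` trade `σ`, which degenerates as `u → 1`, for `ξ η (ξ K +
      -- η L)`, where `K` and `L` are bounded below.
      have hpos : 0 < (56 * ξ ^ 3 + 4 * η ^ 3) *
          (σ * (ξ ^ 2 * (196 + 168 * u) + η ^ 2 * (60 + 24 * u)) + ξ * η * N) := by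
        have e : (56 * ξ ^ 3 + 4 * η ^ 3) *
            (σ * (ξ ^ 2 * (196 + 168 * u) + η ^ 2 * (60 + 24 * u)) + ξ * η * N) =
            ξ * η * ((ξ * K + η * L) * (ξ ^ 2 * (196 + 168 * u) + η ^ 2 * (60 + 24 * u))
              + N * (56 * ξ ^ 3 + 4 * η ^ 3)) := by
          linear_combination (ξ ^ 2 * (196 + 168 * u) + η ^ 2 * (60 + 24 * u)) * h1
        rw [e]
        refine mul_pos (by positivity) ?_
        have e1 : (ξ * 100 + η * 50) * (ξ ^ 2 * 196 + η ^ 2 * 60) ≤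
            (ξ * K + η * L) * (ξ ^ 2 * (196 + 168 * u) + η ^ 2 * (60 + 24 * u)) := by
          gcongr <;> linarith
        have e2 : -297 * (56 * ξ ^ 3 + 4 * η ^ 3) ≤ N * (56 * ξ ^ 3 + 4 * η ^ 3) := by gcongr
        have e3 : 0 < ξ ^ 3 := by positivity
        have e4 : 0 < η ^ 3 := by positivity
        have e5 : 0 < ξ ^ 2 * η := by positivity
        have e6 : 0 < ξ * η ^ 2 := by positivity
        nlinarith
      exact pos_of_mul_pos_right hpos (by positivity)
  have hfin : 0 < 9 * ξ * η * u *
      (σ * (ξ ^ 2 * (196 + 168 * u) + η ^ 2 * (60 + 24 * u)) + ξ * η * N) := by positivity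
  refine ne_of_gt (hfin.trans_eq ?_)
  rw [hN, hσu]
  rw [hσu, hK, hL] at h1
  linear_combination -(1 - u ^ 2) * (10 * ξ + 8 * η) * h1

/-! ### Explicit columns of `M⁻¹` with the first two segments aligned. -/

namespace SwimmerParams

variable (P : SwimmerParams)

/-- A vector sent by `M` to `d (a e₃ + b e₄ + c e₅)` is `d` times the corresponding combination of
the last three columns of `M⁻¹`. -/
theorem columns_eq_of_hydro_eq (hℓ : 0 < P.ℓ) (hξ : 0 < P.ξ) (hη : 0 < P.η) {α₁ α₂ : ℝ}
    {a b c d : ℝ} (hd : d ≠ 0) {N : Fin 5 → ℝ}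
    (h : P.hydro α₁ α₂ N = ![0, 0, d * a, d * b, d * c]) :
    a • P.X₃ α₁ α₂ + b • P.X₄ α₁ α₂ + c • P.X₅ α₁ α₂ = d⁻¹ • N := by
  have hN : N = (P.dragMatrix α₁ α₂)⁻¹.mulVec ![0, 0, d * a, d * b, d * c] := by
    rw [← h, ← dragMatrix_mulVec, Matrix.mulVec_mulVec, Matrix.nonsing_inv_mul _
      (isUnit_iff_ne_zero.2 (P.det_dragMatrix_ne_zero hℓ hξ hη α₁ α₂)), Matrix.one_mulVec]
  rw [hN]
  ext i
  simp [X₃, X₄, X₅, Matrix.mulVec, dotProduct, Fin.sum_univ_succ]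
  field_simp
  ring

/-- The hydrodynamic terms when the first two segments are aligned. -/
theorem hydro_zero_left (α : ℝ) (V : Fin 5 → ℝ) {c s : ℝ} (hc : Real.cos α = c)
    (hs : Real.sin α = s) :
    P.hydro 0 α V = P.ℓ •
      ![-(2 * P.ξ + P.ξ * c ^ 2 + P.η * s ^ 2) * V 0 + (P.η - P.ξ) * c * s * V 1
          + ((-2 * P.ξ * c + P.η / 2 + 2 * P.η * c) * V 2
            + (-P.ξ * c + P.η / 2 + P.η * c) * V 3 + P.η / 2 * V 4) * (s * P.ℓ),
        (P.η - P.ξ) * c * s * V 0 - (P.ξ * s ^ 2 + 2 * P.η + P.η * c ^ 2) * V 1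
          - ((2 * P.ξ * s ^ 2 + 2 * P.η + P.η * c / 2 + 2 * P.η * c ^ 2) * V 2
            + (P.ξ * s ^ 2 + P.η / 2 + P.η * c / 2 + P.η * c ^ 2) * V 3
            + P.η * c / 2 * V 4) * P.ℓ,
        ((-2 * P.ξ * c + P.η / 2 + 2 * P.η * c) * s * V 0
          - (2 * P.ξ * s ^ 2 + 2 * P.η + P.η * c / 2 + 2 * P.η * c ^ 2) * V 1) * P.ℓ
          - ((4 * P.ξ * s ^ 2 + 3 * P.η + 2 * P.η * c + 4 * P.η * c ^ 2) * V 2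
            + (2 * P.ξ * s ^ 2 + 7 / 6 * P.η + 3 / 2 * P.η * c + 2 * P.η * c ^ 2) * V 3
            + (P.η / 3 + P.η * c) * V 4) * P.ℓ ^ 2,
        ((-P.ξ * c + P.η / 2 + P.η * c) * s * V 0
          - (P.ξ * s ^ 2 + P.η / 2 + P.η * c / 2 + P.η * c ^ 2) * V 1) * P.ℓ
          - ((2 * P.ξ * s ^ 2 + 7 / 6 * P.η + 3 / 2 * P.η * c + 2 * P.η * c ^ 2) * V 2
            + (P.ξ * s ^ 2 + 2 / 3 * P.η + P.η * c + P.η * c ^ 2) * V 3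
            + (P.η / 3 + P.η * c / 2) * V 4) * P.ℓ ^ 2,
        (P.η / 2 * s * V 0 - P.η * c / 2 * V 1) * P.ℓ
          - ((P.η / 3 + P.η * c) * V 2 + (P.η / 3 + P.η * c / 2) * V 3 + P.η / 3 * V 4)
            * P.ℓ ^ 2] := by
  have h : s ^ 2 + c ^ 2 = 1 := by rw [← hc, ← hs, Real.sin_sq_add_cos_sq]
  rw [hydro]
  simp only [dragForce_eq, dragTorque_eq, Fin.sum_univ_three, dragDensity, cross, pointVel,
    jointVel, joint, segOmega, segAngle, nrml, tang, dotProduct, Fin.sum_univ_two]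
  ext i
  fin_cases i <;> simp [hc, hs]
  · grind
  · grind
  · grind
  · grind
  · grind

/-- Proportional to the fourth column of `M⁻¹` when the first two segments are aligned; `c` and
`s` are the cosine and sine of the angle of the third one. -/
def col₄ (c s : ℝ) : Fin 5 → ℝ :=
  ![P.ℓ * (12 * s * c * (P.η ^ 2 - 4 * P.ξ * P.η)),
    P.ℓ * (12 * (24 * s ^ 2 * P.ξ ^ 2 + P.ξ * P.η * (11 + 10 * c ^ 2) + P.η ^ 2 * s ^ 2)),
    -6 * (88 * s ^ 2 * P.ξ ^ 2 + P.ξ * P.η * (43 + 38 * c ^ 2) + 4 * P.η ^ 2 * s ^ 2),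
    48 * (16 * s ^ 2 * P.ξ ^ 2 + P.ξ * P.η * (10 + 8 * c ^ 2) + P.η ^ 2 * s ^ 2),
    -6 * (40 * s ^ 2 * P.ξ ^ 2 + P.ξ * P.η * (37 + 36 * c + 26 * c ^ 2) + 4 * P.η ^ 2 * s ^ 2)]

/-- Proportional to the fifth column of `M⁻¹`, with the same factor as `col₄`. -/
def col₅ (c s : ℝ) : Fin 5 → ℝ :=
  ![P.ℓ * (3 * s * (P.ξ * P.η * (14 + 12 * c) + P.η ^ 2 * (4 - 3 * c))),
    P.ℓ * (-3 * (16 * s ^ 2 * P.ξ ^ 2 + P.ξ * P.η * (10 + 6 * c + 8 * c ^ 2) + P.η ^ 2 * s ^ 2)),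
    9 * (16 * s ^ 2 * P.ξ ^ 2 + P.ξ * P.η * (10 + 6 * c + 8 * c ^ 2) + P.η ^ 2 * s ^ 2),
    -6 * (40 * s ^ 2 * P.ξ ^ 2 + P.ξ * P.η * (37 + 36 * c + 26 * c ^ 2) + 4 * P.η ^ 2 * s ^ 2),
    3 * (88 * s ^ 2 * P.ξ ^ 2 + P.ξ * P.η * (88 + 108 * c + 92 * c ^ 2) + 13 * P.η ^ 2 * s ^ 2)]

/-- Proportional to the sum of the last three columns of `M⁻¹`, with the same factor as `col₄`. -/
def colSum (c s : ℝ) : Fin 5 → ℝ :=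
  ![P.ℓ * (6 * s * (7 * P.ξ * P.η + 2 * P.η ^ 2)),
    P.ℓ * (-18 * c * P.ξ * P.η),
    54 * c * P.ξ * P.η,
    -216 * c * P.ξ * P.η,
    6 * (28 * s ^ 2 * P.ξ ^ 2 + P.ξ * P.η * (22 + 27 * c + 32 * c ^ 2) + 4 * P.η ^ 2 * s ^ 2)]

/-- The quadratic factor of the determinant of `M`. -/
def detFactor (c s : ℝ) : ℝ :=
  56 * s ^ 2 * P.ξ ^ 2 + P.ξ * P.η * (23 + 22 * c ^ 2) + 2 * P.η ^ 2 * s ^ 2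

/-- The common factor between `col₄`, `col₅`, `colSum` and the columns of `M⁻¹`. -/
def colFactor (c s : ℝ) : ℝ := -(P.ℓ ^ 3 * P.η * P.detFactor c s)

/-- Multiplying `M` by the candidate column certifies it without inverting `M`. With denominators
cleared, this is a polynomial identity modulo `s ^ 2 + c ^ 2 = 1`. The same holds for the next two
columns. -/
theorem hydro_col₄ (α : ℝ) : P.hydro 0 α (P.col₄ (Real.cos α) (Real.sin α)) =
    ![0, 0, 0, P.colFactor (Real.cos α) (Real.sin α), 0] := by
  rw [P.hydro_zero_left α _ rfl rfl]
  have h := Real.sin_sq_add_cos_sq α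
  generalize Real.sin α = s at *
  generalize Real.cos α = c at *
  ext i
  fin_cases i <;> simp [col₄, colFactor, detFactor]
  · grind
  · grind
  · grind
  · grind
  · grind

theorem hydro_col₅ (α : ℝ) : P.hydro 0 α (P.col₅ (Real.cos α) (Real.sin α)) =
    ![0, 0, 0, 0, P.colFactor (Real.cos α) (Real.sin α)] := by
  rw [P.hydro_zero_left α _ rfl rfl]
  have h := Real.sin_sq_add_cos_sq α
  generalize Real.sin α = s at *
  generalize Real.cos α = c at *
  ext i
  fin_cases i <;> simp [col₅, colFactor, detFactor]
  · grind
  · grind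
  · grind
  · grind
  · grind

theorem hydro_colSum (α : ℝ) : P.hydro 0 α (P.colSum (Real.cos α) (Real.sin α)) =
    ![0, 0, P.colFactor (Real.cos α) (Real.sin α), P.colFactor (Real.cos α) (Real.sin α),
      P.colFactor (Real.cos α) (Real.sin α)] := by
  rw [P.hydro_zero_left α _ rfl rfl]
  have h := Real.sin_sq_add_cos_sq α
  generalize Real.sin α = s at *
  generalize Real.cos α = c at *
  ext i
  fin_cases i <;> simp [colSum, colFactor, detFactor]
  · grind
  · grind
  · grind
  · grind
  · grind

/-! ### The Kalman condition on the explicit columns. -/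

/-- The linear part of the drift at rest, up to the factor `-κ`, for the columns `X₄`, `X₅`
given by `p`, `q`. -/
def elastic (p q V : Fin 5 → ℝ) : Fin 5 → ℝ := V 3 • p + V 4 • q

/-- The position components of `colSum` and of its first two images under the linearised drift
span the plane. -/
theorem col_kalman (hℓ : 0 < P.ℓ) (hξ : 0 < P.ξ) (hη : 0 < P.η) {c s : ℝ} (h : s ^ 2 + c ^ 2 = 1)
    (hs : s ≠ 0) {m₀ m₁ : ℝ} (h₀ : m₀ * P.colSum c s 0 + m₁ * P.colSum c s 1 = 0)
    (h₁ : m₀ * elastic (P.col₄ c s) (P.col₅ c s) (P.colSum c s) 0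
      + m₁ * elastic (P.col₄ c s) (P.col₅ c s) (P.colSum c s) 1 = 0)
    (h₂ : m₀ * elastic (P.col₄ c s) (P.col₅ c s)
        (elastic (P.col₄ c s) (P.col₅ c s) (P.colSum c s)) 0
      + m₁ * elastic (P.col₄ c s) (P.col₅ c s)
        (elastic (P.col₄ c s) (P.col₅ c s) (P.colSum c s)) 1 = 0) :
    m₀ = 0 ∧ m₁ = 0 := by
  have hs2 : 0 < s ^ 2 := by positivity
  have hc2 : c ^ 2 < 1 := by linarith
  have hQ : 0 < P.detFactor c s := by unfold detFactor; positivity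
  have hdet : ∀ a b a' b' : ℝ, a * b' - b * a' ≠ 0 → m₀ * a + m₁ * b = 0 → m₀ * a' + m₁ * b' = 0 →
      m₀ = 0 ∧ m₁ = 0 := by
    intro a b a' b' hd ha hb
    constructor
    · exact (mul_eq_zero.1 (by linear_combination b' * ha - b * hb : m₀ * (a * b' - b * a') = 0)
        ).resolve_right hd
    · exact (mul_eq_zero.1 (by linear_combination a * hb - a' * ha : m₁ * (a * b' - b * a') = 0)
        ).resolve_right hd
  have e01 : P.colSum c s 0 * elastic (P.col₄ c s) (P.col₅ c s) (P.colSum c s) 1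
      - P.colSum c s 1 * elastic (P.col₄ c s) (P.col₅ c s) (P.colSum c s) 0 =
      -(108 * P.ℓ ^ 2 * P.η * P.detFactor c s * s) *
      ((1 - c ^ 2) * (56 * P.ξ ^ 3 + 4 * P.η ^ 3) + P.ξ ^ 2 * P.η * (72 + 486 * c + 36 * c ^ 2)
      + P.ξ * P.η ^ 2 * (30 + 171 * c + 24 * c ^ 2)) := by
    simp [elastic, colSum, col₄, col₅, detFactor]
    grind
  have ew : P.colSum c s 3 * elastic (P.col₄ c s) (P.col₅ c s) (P.colSum c s) 4
      - P.colSum c s 4 * elastic (P.col₄ c s) (P.col₅ c s) (P.colSum c s) 3 =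
      216 * P.detFactor c s *
      (560 * (1 - c ^ 2) ^ 2 * P.ξ ^ 4
      + P.ξ ^ 3 * P.η * (1 - c ^ 2) * (1168 + 3096 * c + 1424 * c ^ 2)
      + P.ξ ^ 2 * P.η ^ 2 * (876 + 3204 * c + 2379 * c ^ 2 + 3924 * c ^ 3 + 1200 * c ^ 4)
      + P.ξ * P.η ^ 3 * (1 - c ^ 2) * (280 + 828 * c + 368 * c ^ 2)
      + 32 * P.η ^ 4 * (1 - c ^ 2) ^ 2) := by
    simp [elastic, colSum, col₄, col₅, detFactor]
    grind
  have e5 : P.colSum c s 0 * P.col₅ c s 1 - P.colSum c s 1 * P.col₅ c s 0 =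
      -(18 * P.ℓ ^ 2 * P.η * P.detFactor c s * s * (2 * P.ξ + P.η)) := by
    simp [colSum, col₅, detFactor]
    grind
  by_cases h01 : (1 - c ^ 2) * (56 * P.ξ ^ 3 + 4 * P.η ^ 3)
      + P.ξ ^ 2 * P.η * (72 + 486 * c + 36 * c ^ 2)
      + P.ξ * P.η ^ 2 * (30 + 171 * c + 24 * c ^ 2) = 0
  · have hw := kalman_polynomials_coprime hξ hη hc2 h01
    have hw' := mul_ne_zero (mul_ne_zero (by norm_num : (216 : ℝ) ≠ 0) hQ.ne') hw
    rw [← ew] at hw'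
    -- Now `h₁` and `h₂` form a homogeneous 2×2 system in the pairings of `(m₀, m₁)` with the
    -- position parts of `col₄` and `col₅`. Its determinant is nonzero by `hw'`, so the pairing with
    -- `col₅` vanishes; by `e5`, `col₅` and `colSum` have independent position parts.
    set W := elastic (P.col₄ c s) (P.col₅ c s) (P.colSum c s) with hW
    have h₁' : P.colSum c s 3 * (m₀ * P.col₄ c s 0 + m₁ * P.col₄ c s 1)
        + P.colSum c s 4 * (m₀ * P.col₅ c s 0 + m₁ * P.col₅ c s 1) = 0 := by
      rw [← h₁, hW]
      simp only [elastic, Pi.add_apply, Pi.smul_apply, smul_eq_mul]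
      ring
    have h₂' : W 3 * (m₀ * P.col₄ c s 0 + m₁ * P.col₄ c s 1)
        + W 4 * (m₀ * P.col₅ c s 0 + m₁ * P.col₅ c s 1) = 0 := by
      rw [← h₂]
      simp only [elastic, Pi.add_apply, Pi.smul_apply, smul_eq_mul]
      ring
    have h5 : m₀ * P.col₅ c s 0 + m₁ * P.col₅ c s 1 = 0 :=
      (mul_eq_zero.1 (by linear_combination P.colSum c s 3 * h₂' - W 3 * h₁' :
        (P.colSum c s 3 * W 4 - P.colSum c s 4 * W 3) * _ = 0)).resolve_left hw'
    refine hdet _ _ _ _ ?_ h₀ h5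
    rw [e5]
    exact neg_ne_zero.2 (by positivity)
  · refine hdet _ _ _ _ ?_ h₀ h₁
    rw [e01]
    exact mul_ne_zero (neg_ne_zero.2 (by positivity)) h01

/-! ### Smoothness of the field. -/

theorem contDiff_dragMatrix (i j : Fin 5) :
    ContDiff ℝ 1 fun a : ℝ × ℝ => P.dragMatrix a.1 a.2 i j := by
  simp only [dragMatrix, Matrix.of_apply, hydro, dragForce_eq, dragTorque_eq, Fin.sum_univ_three,
    dragDensity, cross, pointVel, jointVel, joint, segOmega, segAngle, nrml, tang, dotProduct,
    Fin.sum_univ_two]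
  generalize (Pi.single j 1 : Fin 5 → ℝ) = V
  fin_cases i <;> simp <;> fun_prop

/-- Cramer's rule: the entries are minors of `M`, up to sign, divided by a determinant that never
vanishes. -/
theorem contDiff_inv_dragMatrix (hℓ : 0 < P.ℓ) (hξ : 0 < P.ξ) (hη : 0 < P.η) (i j : Fin 5) :
    ContDiff ℝ 1 fun a : ℝ × ℝ => (P.dragMatrix a.1 a.2)⁻¹ i j := by
  have hdet : ∀ B : ℝ × ℝ → Matrix (Fin 5) (Fin 5) ℝ, (∀ i j, ContDiff ℝ 1 fun a => B a i j) →
      ContDiff ℝ 1 fun a => (B a).det := by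
    intro B hB
    simp only [Matrix.det_apply']
    exact ContDiff.sum fun σ _ => contDiff_const.mul (contDiff_prod fun k _ => hB _ _)
  simp only [Matrix.inv_def, Matrix.smul_apply, Ring.inverse_eq_inv', smul_eq_mul,
    Matrix.adjugate_apply]
  refine ((hdet _ P.contDiff_dragMatrix).inv fun a => P.det_dragMatrix_ne_zero hℓ hξ hη _ _).mul
    (hdet _ fun k l => ?_)
  simp only [Matrix.updateRow_apply]
  split_ifs
  · exact contDiff_const
  · exact P.contDiff_dragMatrix k l

theorem contDiff_X₃ (hℓ : 0 < P.ℓ) (hξ : 0 < P.ξ) (hη : 0 < P.η) :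
    ContDiff ℝ 1 fun a : ℝ × ℝ => P.X₃ a.1 a.2 :=
  contDiff_pi.2 fun i => P.contDiff_inv_dragMatrix hℓ hξ hη i 2

theorem contDiff_X₄ (hℓ : 0 < P.ℓ) (hξ : 0 < P.ξ) (hη : 0 < P.η) :
    ContDiff ℝ 1 fun a : ℝ × ℝ => P.X₄ a.1 a.2 :=
  contDiff_pi.2 fun i => P.contDiff_inv_dragMatrix hℓ hξ hη i 3

theorem contDiff_X₅ (hℓ : 0 < P.ℓ) (hξ : 0 < P.ξ) (hη : 0 < P.η) :
    ContDiff ℝ 1 fun a : ℝ × ℝ => P.X₅ a.1 a.2 :=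
  contDiff_pi.2 fun i => P.contDiff_inv_dragMatrix hℓ hξ hη i 4

/-- A vector of `ℝ⁵`, rotated by `R_θ` and split into its position and shape components. -/
def rotState (θ : ℝ) :
    (Fin 5 → ℝ) →ₗ[ℝ] EuclideanSpace ℝ (Fin 2) × EuclideanSpace ℝ (Fin 3) where
  toFun W := (W 0 • !₂[Real.cos θ, Real.sin θ] + W 1 • !₂[-Real.sin θ, Real.cos θ],
    !₂[W 2, W 3, W 4])
  map_add' V W := by
    refine Prod.ext ?_ ?_
    · simp only [Pi.add_apply, Prod.fst_add]; module
    · ext i; fin_cases i <;> simp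
  map_smul' r W := by
    refine Prod.ext ?_ ?_
    · simp only [Pi.smul_apply, Prod.smul_fst, smul_eq_mul, RingHom.id_apply]; module
    · ext i; fin_cases i <;> simp

theorem vectorField_eq (Z : EuclideanSpace ℝ (Fin 2) × EuclideanSpace ℝ (Fin 3))
    (H : EuclideanSpace ℝ (Fin 2)) :
    P.vectorField Z H = rotState (Z.2 0) (P.F₀ (Z.2 1) (Z.2 2) + H 0 • P.F₁ (Z.2 1) (Z.2 2)
      + H 1 • P.F₂ (Z.2 1) (Z.2 2)) := by
  unfold vectorField velocity
  generalize P.F₀ (Z.2 1) (Z.2 2) + H 0 • P.F₁ (Z.2 1) (Z.2 2) + H 1 • P.F₂ (Z.2 1) (Z.2 2) = W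
  refine Prod.ext ?_ ?_ <;> ext i <;> fin_cases i <;>
    simp [rotState, rotMatrix, Matrix.mulVec, dotProduct, Fin.sum_univ_succ] <;> ring

theorem contDiff_rotState {E : Type*} [NormedAddCommGroup E] [NormedSpace ℝ E] {a : E → ℝ}
    {W : E → Fin 5 → ℝ} (ha : ContDiff ℝ 1 a) (hW : ContDiff ℝ 1 W) :
    ContDiff ℝ 1 fun z => rotState (a z) (W z) := by
  have hW' := contDiff_pi.1 hW
  refine ContDiff.prodMk ?_ ?_ <;> refine contDiff_euclidean.2 fun i => ?_
  · fin_cases i <;> simp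
    · exact ((hW' 0).mul ha.cos).add ((hW' 1).mul ha.sin).neg
    · exact ((hW' 0).mul ha.sin).add ((hW' 1).mul ha.cos)
  · fin_cases i <;> simp <;> exact hW' _

/-- The swimmer controlled by the tangential component of the magnetic field only. -/
def tangentialField (w : (EuclideanSpace ℝ (Fin 2) × EuclideanSpace ℝ (Fin 3)) × ℝ) :
    EuclideanSpace ℝ (Fin 2) × EuclideanSpace ℝ (Fin 3) :=
  P.vectorField w.1 !₂[w.2, 0]

theorem tangentialField_eq (w : (EuclideanSpace ℝ (Fin 2) × EuclideanSpace ℝ (Fin 3)) × ℝ) :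
    P.tangentialField w = rotState (w.1.2 0)
      (P.F₀ (w.1.2 1) (w.1.2 2) + w.2 • P.F₁ (w.1.2 1) (w.1.2 2)) := by
  rw [tangentialField, vectorField_eq]
  simp

theorem contDiff_tangentialField (hℓ : 0 < P.ℓ) (hξ : 0 < P.ξ) (hη : 0 < P.η) :
    ContDiff ℝ 1 P.tangentialField := by
  have hz : ∀ i, ContDiff ℝ 1
      fun w : (EuclideanSpace ℝ (Fin 2) × EuclideanSpace ℝ (Fin 3)) × ℝ => w.1.2 i := fun i =>
    (EuclideanSpace.proj (𝕜 := ℝ) i).contDiff.comp (contDiff_snd.comp contDiff_fst)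
  have h3 := (P.contDiff_X₃ hℓ hξ hη).comp ((hz 1).prodMk (hz 2))
  have h4 := (P.contDiff_X₄ hℓ hξ hη).comp ((hz 1).prodMk (hz 2))
  have h5 := (P.contDiff_X₅ hℓ hξ hη).comp ((hz 1).prodMk (hz 2))
  have h1 := hz 1
  have h2 := hz 2
  rw [funext P.tangentialField_eq]
  refine contDiff_rotState (hz 0) ?_
  unfold F₀ F₁
  refine ContDiff.add (ContDiff.const_smul (-P.κ) ?_) (contDiff_snd.smul ?_)
  · exact (h1.smul h4).add ((h2.sub contDiff_const).smul h5)
  · have hs := contDiff_const (c := P.M₃) |>.mul (h1.add h2).sin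
    exact (((contDiff_const.mul h1.sin).add hs).smul (h3.add h4)).add (hs.smul h5)

/-! ### Linearisation at rest. -/

/-- The slope at `0` is `g t` itself, so continuity of `g` suffices. This is why no derivative of
the columns of `M⁻¹` is ever computed. -/
theorem hasDerivAt_smul_zero {E : Type*} [NormedAddCommGroup E] [NormedSpace ℝ E] {g : ℝ → E}
    (hg : ContinuousAt g 0) : HasDerivAt (fun t => t • g t) (g 0) 0 := by
  rw [hasDerivAt_iff_tendsto_slope_zero]
  refine (hg.tendsto.mono_left nhdsWithin_le_nhds).congr' ?_
  filter_upwards [self_mem_nhdsWithin] with t ht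
  have ht' : t ≠ 0 := ht
  simp [smul_smul, inv_mul_cancel₀ ht']

/-- The action of a derivative along lines on which the map has a linear factor. -/
theorem fderiv_apply_of_eq_smul {E F : Type*} [NormedAddCommGroup E] [NormedSpace ℝ E]
    [NormedAddCommGroup F] [NormedSpace ℝ F] {f : E → F} {f' : E →L[ℝ] F} {x v : E} {g : ℝ → F}
    (hf : HasFDerivAt f f' x) (hg : ContinuousAt g 0) (h : ∀ t : ℝ, f (x + t • v) = t • g t) :
    f' v = g 0 := by
  have h1 : HasDerivAt (fun t : ℝ => x + t • v) v 0 := by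
    simpa using ((hasDerivAt_id (0 : ℝ)).smul_const v).const_add x
  have h2 : HasFDerivAt f f' (x + (0 : ℝ) • v) := by simpa using hf
  have h3 := h2.comp_hasDerivAt 0 h1
  have h4 : (f ∘ fun t : ℝ => x + t • v) = fun t => t • g t := funext h
  rw [h4] at h3
  exact h3.unique (hasDerivAt_smul_zero hg)

theorem colFactor_ne_zero {P : SwimmerParams} (hℓ : 0 < P.ℓ) (hξ : 0 < P.ξ) (hη : 0 < P.η)
    {c s : ℝ} (hs : s ≠ 0) : P.colFactor c s ≠ 0 := by
  have : 0 < s ^ 2 := by positivity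
  unfold colFactor detFactor
  exact neg_ne_zero.2 (by positivity)

theorem F₀_rest : P.F₀ 0 P.α₀ = 0 := by simp [F₀]

/-- The derivative of the field at rest in the direction of the control. -/
theorem linearization_control (hℓ : 0 < P.ℓ) (hξ : 0 < P.ξ) (hη : 0 < P.η) {x y θ : ℝ}
    {f' : (EuclideanSpace ℝ (Fin 2) × EuclideanSpace ℝ (Fin 3)) × ℝ →L[ℝ]
      EuclideanSpace ℝ (Fin 2) × EuclideanSpace ℝ (Fin 3)}
    (hf' : HasFDerivAt P.tangentialField f' ((!₂[x, y], !₂[θ, 0, P.α₀]), 0))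
    (hs : Real.sin P.α₀ ≠ 0) :
    f' (0, 1) = (P.M₃ * Real.sin P.α₀ * (P.colFactor (Real.cos P.α₀) (Real.sin P.α₀))⁻¹) •
      rotState θ (P.colSum (Real.cos P.α₀) (Real.sin P.α₀)) := by
  have hc := P.columns_eq_of_hydro_eq hℓ hξ hη (a := 1) (b := 1) (c := 1)
    (colFactor_ne_zero hℓ hξ hη hs) (by simpa using P.hydro_colSum P.α₀)
  have hF : P.F₁ 0 P.α₀ = (P.M₃ * Real.sin P.α₀ *
      (P.colFactor (Real.cos P.α₀) (Real.sin P.α₀))⁻¹) •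
        P.colSum (Real.cos P.α₀) (Real.sin P.α₀) := by
    rw [mul_smul, ← hc]
    simp only [F₁, Real.sin_zero, zero_add, mul_zero]
    module
  rw [← map_smul, ← hF]
  refine fderiv_apply_of_eq_smul (g := fun _ => rotState θ (P.F₁ 0 P.α₀)) hf'
    continuousAt_const fun t => ?_
  rw [tangentialField_eq]
  simp [F₀_rest]

/-- The derivative of the field at rest in the direction of the state. -/
theorem linearization_state (hℓ : 0 < P.ℓ) (hξ : 0 < P.ξ) (hη : 0 < P.η) {x y θ : ℝ}
    {f' : (EuclideanSpace ℝ (Fin 2) × EuclideanSpace ℝ (Fin 3)) × ℝ →L[ℝ]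
      EuclideanSpace ℝ (Fin 2) × EuclideanSpace ℝ (Fin 3)}
    (hf' : HasFDerivAt P.tangentialField f' ((!₂[x, y], !₂[θ, 0, P.α₀]), 0))
    (hs : Real.sin P.α₀ ≠ 0) (W : Fin 5 → ℝ) :
    f' (rotState θ W, 0) = (-P.κ * (P.colFactor (Real.cos P.α₀) (Real.sin P.α₀))⁻¹) •
      rotState θ (elastic (P.col₄ (Real.cos P.α₀) (Real.sin P.α₀))
        (P.col₅ (Real.cos P.α₀) (Real.sin P.α₀)) W) := by
  have hd := colFactor_ne_zero hℓ hξ hη hs (c := Real.cos P.α₀)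
  have h4 := P.columns_eq_of_hydro_eq hℓ hξ hη (a := 0) (b := 1) (c := 0) hd
    (by simpa using P.hydro_col₄ P.α₀)
  have h5 := P.columns_eq_of_hydro_eq hℓ hξ hη (a := 0) (b := 0) (c := 1) hd
    (by simpa using P.hydro_col₅ P.α₀)
  simp only [zero_smul, one_smul, zero_add, add_zero] at h4 h5
  -- Along the line through rest in the direction `W`, the spring torques are linear in `t`. This is
  -- the cofactor of `t`; its value at `t = 0` is the derivative sought.
  have hc : Continuous fun t : ℝ => rotState (θ + t * W 2)
      (-P.κ • (W 3 • P.X₄ (t * W 3) (P.α₀ + t * W 4) + W 4 • P.X₅ (t * W 3) (P.α₀ + t * W 4))) := by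
    have ha : ContDiff ℝ 1 fun t : ℝ => (t * W 3, P.α₀ + t * W 4) := by fun_prop
    have h4c := (P.contDiff_X₄ hℓ hξ hη).comp ha
    have h5c := (P.contDiff_X₅ hℓ hξ hη).comp ha
    have hθ : ContDiff ℝ 1 fun t : ℝ => θ + t * W 2 := by fun_prop
    exact (contDiff_rotState hθ
      (((h4c.const_smul (W 3)).add (h5c.const_smul (W 4))).const_smul (-P.κ))).continuous
  refine (fderiv_apply_of_eq_smul hf' hc.continuousAt fun t => ?_).trans ?_
  · rw [tangentialField_eq, ← map_smul]
    have e0 : (((!₂[x, y], !₂[θ, 0, P.α₀]), (0 : ℝ)) + t • (rotState θ W, (0 : ℝ))).1.2 0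
      = θ + t * W 2 := rfl
    have e1 : (((!₂[x, y], !₂[θ, 0, P.α₀]), (0 : ℝ)) + t • (rotState θ W, (0 : ℝ))).1.2 1
      = 0 + t * W 3 := rfl
    have e2 : (((!₂[x, y], !₂[θ, 0, P.α₀]), (0 : ℝ)) + t • (rotState θ W, (0 : ℝ))).1.2 2
      = P.α₀ + t * W 4 := rfl
    have e3 : (((!₂[x, y], !₂[θ, 0, P.α₀]), (0 : ℝ)) + t • (rotState θ W, (0 : ℝ))).2
      = 0 := by simp
    rw [e0, e1, e2, e3, zero_smul, add_zero, zero_add, F₀]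
    congr 1
    module
  · simp only [zero_mul, add_zero]
    rw [h4, h5, ← map_smul, elastic]
    congr 1
    module

/-- The partial Kalman condition for the position of the swimmer. -/
theorem kalman_position (hℓ : 0 < P.ℓ) (hξ : 0 < P.ξ) (hη : 0 < P.η) (hκ : P.κ ≠ 0)
    (hM₃ : P.M₃ ≠ 0) (hs : Real.sin P.α₀ ≠ 0) {x y θ : ℝ}
    {f' : (EuclideanSpace ℝ (Fin 2) × EuclideanSpace ℝ (Fin 3)) × ℝ →L[ℝ]
      EuclideanSpace ℝ (Fin 2) × EuclideanSpace ℝ (Fin 3)}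
    (hf' : HasFDerivAt P.tangentialField f' ((!₂[x, y], !₂[θ, 0, P.α₀]), 0))
    (l : EuclideanSpace ℝ (Fin 2) →ₗ[ℝ] ℝ)
    (hl : ∀ n : ℕ, l (((f'.comp (.inl ℝ _ ℝ)) ^ n) (f' (0, 1))).1 = 0) : l = 0 := by
  have hd := colFactor_ne_zero hℓ hξ hη hs (c := Real.cos P.α₀)
  have hb := P.linearization_control hℓ hξ hη hf' hs
  have hA := P.linearization_state hℓ hξ hη hf' hs
  have hsc := Real.sin_sq_add_cos_sq P.α₀
  set c := Real.cos P.α₀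
  set s := Real.sin P.α₀
  set μ := P.M₃ * s * (P.colFactor c s)⁻¹
  set ν := -P.κ * (P.colFactor c s)⁻¹
  have hμ : μ ≠ 0 := mul_ne_zero (mul_ne_zero hM₃ hs) (inv_ne_zero hd)
  have hν : ν ≠ 0 := mul_ne_zero (neg_ne_zero.2 hκ) (inv_ne_zero hd)
  set A := f'.comp (.inl ℝ _ ℝ)
  have hA' : ∀ W, A (rotState θ W) = ν • rotState θ (elastic (P.col₄ c s) (P.col₅ c s) W) := hA
  have hlW : ∀ W, l (rotState θ W).1 = l !₂[Real.cos θ, Real.sin θ] * W 0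
      + l !₂[-Real.sin θ, Real.cos θ] * W 1 := by
    intro W
    change l (W 0 • !₂[Real.cos θ, Real.sin θ] + W 1 • !₂[-Real.sin θ, Real.cos θ]) = _
    simp only [map_add, map_smul, smul_eq_mul]
    ring
  -- In the frame rotated by `θ`, the first three Kalman vectors become, up to nonzero factors,
  -- `colSum` and its first two images under `elastic`.
  have h0 := hl 0
  have h1 := hl 1
  have h2 := hl 2
  rw [hb] at h0 h1 h2
  simp only [pow_two, pow_one, pow_zero, mul_apply_eq_comp,
    one_apply_eq_self, map_smul, hA', Prod.smul_fst, smul_eq_mul, mul_eq_zero, hμ, hν,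
    false_or, hlW] at h0 h1 h2
  obtain ⟨hm₀, hm₁⟩ := P.col_kalman hℓ hξ hη hsc hs h0 h1 h2
  ext v
  have hv : v = (v 0 * Real.cos θ + v 1 * Real.sin θ) • !₂[Real.cos θ, Real.sin θ]
      + (-v 0 * Real.sin θ + v 1 * Real.cos θ) • !₂[-Real.sin θ, Real.cos θ] := by
    have := Real.sin_sq_add_cos_sq θ
    ext i
    fin_cases i <;> simp <;> grind
  rw [hv]
  simp [hm₀, hm₁]

end SwimmerParams

end

/-! ### Conclusion for the swimmer. -/

theorem theorem3 (P : SwimmerParams) (hℓ : 0 < P.ℓ) (hξ : 0 < P.ξ) (hη : 0 < P.η)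
    (hκ : P.κ ≠ 0) (hM₃ : P.M₃ ≠ 0) (hα₀_mem : P.α₀ ∈ Set.Ioo (-Real.pi) Real.pi)
    (hα₀ : P.α₀ ≠ 0) (x y θ : ℝ) :
    IsSTLPC P.vectorField !₂[x, y] !₂[θ, 0, P.α₀] 0 := by
  have hs : Real.sin P.α₀ ≠ 0 := by
    rcases lt_or_gt_of_ne hα₀ with h | h
    · exact (Real.sin_neg_of_neg_of_neg_pi_lt h hα₀_mem.1).ne
    · exact (Real.sin_pos_of_pos_of_lt_pi h hα₀_mem.2).ne'
  have hcd := P.contDiff_tangentialField hℓ hξ hη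
  have hf' := hcd.contDiffAt.hasStrictFDerivAt (x := ((!₂[x, y], !₂[θ, 0, P.α₀]), 0)) one_ne_zero
  have h0 : P.tangentialField ((!₂[x, y], !₂[θ, 0, P.α₀]), 0) = 0 := by
    rw [P.tangentialField_eq]
    simp [P.F₀_rest]
  refine ⟨?_, fun ε hε => ?_⟩
  · rw [← h0, SwimmerParams.tangentialField]
    congr 1
    ext i
    fin_cases i <;> rfl
  -- Both the time horizon and the control bound are taken equal to `ε`.
  have hev := eventually_exists_steering hcd.continuous hf' h0 (ContinuousLinearMap.fst ℝ _ _)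
    (P.kalman_position hℓ hξ hη hκ hM₃ hs hf'.hasFDerivAt) hε hε
  obtain ⟨δ, hδ, hball⟩ := Metric.eventually_nhds_iff_ball.1 hev
  refine ⟨δ, hδ, fun p₀ hp₀ q₀ hq₀ pf hpf => ?_⟩
  have hmem : ((p₀, q₀), pf) ∈ Metric.ball ((!₂[x, y], !₂[θ, 0, P.α₀]), !₂[x, y]) δ := by
    rw [← ball_prod_same, ← ball_prod_same]
    exact ⟨⟨hp₀, hq₀⟩, hpf⟩
  obtain ⟨Z, h, hZ, hh, hhε, hsol, hend⟩ := hball _ hmem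
  have hu : Continuous fun t => (!₂[h t, 0] : EuclideanSpace ℝ (Fin 2)) := by fun_prop
  have hnorm : ∀ t, ‖(!₂[h t, 0] : EuclideanSpace ℝ (Fin 2))‖ ≤ ε := fun t => by
    simpa [EuclideanSpace.norm_eq, Real.sqrt_sq_eq_abs] using hhε t
  have hZ0 : Z 0 = (p₀, q₀) := by simpa using hsol 0 ⟨le_rfl, hε.le⟩
  refine ⟨fun t => !₂[h t, 0],
    MemLp.of_bound hu.aestronglyMeasurable ε (Filter.Eventually.of_forall hnorm),
    fun t _ => by rw [sub_zero]; exact hnorm t, Z, ⟨hZ.continuousOn, ?_, ?_⟩, hZ0, hend⟩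
  · exact (hcd.continuous.comp (hZ.prodMk hh)).intervalIntegrable _ _
  · rw [hZ0]
    exact hsol
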